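/- Fix the following notions. For $n\ge 1$ and a positive integer $s$, let $\mathcal M^{(n)}_s$ be the set of block matrices $A=(A_{ij})_{i,j=1}^n$ whose entries are positive semidefinite complex $s\times s$ matrices with $\sum_{k}A_{ik}=I_s$ and $\sum_k A_{kj}=I_s$ for all $i,j$, and let $\mathcal M^{(n)}=\bigcup_{s\ge1}\mathcal M^{(n)}_s$ be the set of quantum magic squares. For a finite simple graph $\Gamma$ on $n$ vertices with adjacency matrix $A_\Gamma$, let $\mathcal M^{(\Gamma)}_s$ be the set of those $X\in\mathcal M^{(n)}_s$ (with rows and columns indexed by the vertices of $\Gamma$) that commute with the block matrix whose $(i,j)$ block is $(A_\Gamma)_{ij}I_s$, and let $\mathcal M^{(\Gamma)}=\bigcup_{s\ge1}\mathcal M^{(\Gamma)}_s$. A set $R=\bigcup_{s\ge1}R_s$, where $R_s$ consists of $n\times n$ block matrices with Hermitian $s\times s$ entries, is called matrix convex if for all $s,t\ge1$, all $A^{(1)},\dots,A^{(m)}\in R_s$ and all complex $s\times t$ matrices $V_1,\dots,V_m$ with $\sum_r V_r^*V_r=I_t$, the block matrix with $(i,j)$ entry $\sum_r V_r^*A^{(r)}_{ij}V_r$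 belongs to $R_t$. The matrix convex hull $\operatorname{mconv}(S)$ is the smallest matrix convex set containing $S$. A point $X\in R_s$ is an Arveson extreme point of $R$ if, for all $\ell\ge1$, whenever the block matrix with $(i,j)$ entry $$\begin{pmatrix}X_{ij}&\beta_{ij}\\ \beta_{ij}^*&\gamma_{ij}\end{pmatrix}$$ belongs to $R_{s+\ell}$, one has $\beta_{ij}=0$ for all $i,j$. Write $\operatorname{ArvesonExt}(R)$ for the set of Arveson extreme points of $R$. **Corollary.** For every $n$, $$\mathcal M^{(n)}=\operatorname{mconv}\bigl(\operatorname{ArvesonExt}(\mathcal M^{(n)})\bigr).$$ Moreover, for every $k$ and every finite $k$-regular simple graph $\Gamma$, $$\mathcal M^{(\Gamma)}=\operatorname{mconv}\bigl(\operatorname{ArvesonExt}(\mathcal M^{(\Gamma)})\bigr).$$ -/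

import Mathlib

open scoped Matrix ComplexOrder

/-- Block matrices with rows and columns indexed by `ι` (external indices), whose entries are
complex `s × s` matrices. For `ι = Fin n` this is `Mat_n(Mat_s(ℂ))`. -/
abbrev BlockMat (ι : Type*) (s : ℕ) : Type _ := Matrix ι ι (Matrix (Fin s) (Fin s) ℂ)

/-- A set `R = ⋃_{s ≥ 1} R_s` of block matrices, given by its levels `R_s`, `s` a positive
integer. -/
abbrev LevelSet (ι : Type*) : Type _ := (s : ℕ+) → Set (BlockMat ι s)

/-- Quantum magic squares: positive semidefinite entries, all block rows and all block columns
sum to the identity matrix `I_s`. -/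
def quantumMagicSquares (ι : Type*) [Fintype ι] : LevelSet ι := fun _ =>
  {A | (∀ i j, (A i j).PosSemidef) ∧ (∀ i, ∑ k, A i k = 1) ∧ (∀ j, ∑ k, A k j = 1)}

/-- Graph quantum magic squares: quantum magic squares that commute with the adjacency matrix
of `Γ` tensored with `I_s`, i.e. with the block matrix whose `(i, j)` block is `I_s` if `i ∼ j`
and `0` otherwise. -/
def graphQuantumMagicSquares {V : Type*} [Fintype V] (Γ : SimpleGraph V)
    [DecidableRel Γ.Adj] : LevelSet V := fun s =>
  {X | X ∈ quantumMagicSquares V s ∧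
    X * Γ.adjMatrix (Matrix (Fin s) (Fin s) ℂ) = Γ.adjMatrix (Matrix (Fin s) (Fin s) ℂ) * X}

/-- Matrix convexity of a set of block matrices with Hermitian entries: it is closed under
matrix-valued convex combinations `∑ r, V_r^* A^{(r)} V_r`, conjugation acting blockwise. -/
def IsMatrixConvex {ι : Type*} (R : LevelSet ι) : Prop :=
  (∀ (s : ℕ+) (A : BlockMat ι s), A ∈ R s → ∀ i j, (A i j).IsHermitian) ∧
  ∀ (s t : ℕ+) (m : ℕ) (A : Fin m → BlockMat ι s) (V : Fin m → Matrix (Fin s) (Fin t) ℂ),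
    (∀ r, A r ∈ R s) → ∑ r, (V r)ᴴ * V r = 1 →
      (Matrix.of fun i j => ∑ r, (V r)ᴴ * A r i j * V r) ∈ R t

/-- The matrix convex hull: the smallest matrix convex set containing `S` (meant for sets `S` of
block matrices with Hermitian entries). -/
def matrixConvexHull {ι : Type*} (S : LevelSet ι) : LevelSet ι := fun s =>
  {X | ∀ R : LevelSet ι, IsMatrixConvex R → (∀ t, S t ⊆ R t) → X ∈ R s}

/-- The block matrix whose `(i, j)` entry is the `(s + l) × (s + l)` matrix
`[X i j, β i j; (β i j)^*, γ i j]`. -/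
def dilationMatrix {ι : Type*} {s l : ℕ+} (X : BlockMat ι s)
    (β : ι → ι → Matrix (Fin s) (Fin l) ℂ) (γ : BlockMat ι l) : BlockMat ι (s + l : ℕ+) :=
  Matrix.of fun i j =>
    Matrix.reindex (finSumFinEquiv.trans (finCongr (PNat.add_coe s l).symm))
      (finSumFinEquiv.trans (finCongr (PNat.add_coe s l).symm))
      (Matrix.fromBlocks (X i j) (β i j) (β i j)ᴴ (γ i j))

/-- Arveson extreme points of `R`: those `X ∈ R` all of whose dilations inside `R` are
trivial. -/
def arvesonExtremePoints {ι : Type*} (R : LevelSet ι) : LevelSet ι := fun s =>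
  {X | X ∈ R s ∧
    ∀ (l : ℕ+) (β : ι → ι → Matrix (Fin s) (Fin l) ℂ) (γ : BlockMat ι l),
      dilationMatrix X β γ ∈ R (s + l) → ∀ i j, β i j = 0}

/-! A graph quantum magic square is a tuple of positive semidefinite matrices `X e` subject to real
affine equations `∑ e, a c e • X e = b c • 1`. Two features matter: the row equations have
nonnegative coefficients, which bounds everything, and regularity of the graph makes the strictly
positive scalar tuple `1/n` a solution.

If a dilation of `X` stays in the set, each column of its off-diagonal blocks lies in
`dilationSubspace a X`: positivity puts it in the ranges of the `X e`, and the equations become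
homogeneous. So a zero subspace makes `X` Arveson extreme.

If the subspace is nonzero, compactness gives a one-dimensional dilation `Y` of `X` with border `v ≠
0` of maximal norm and, for that `v`, corner entries `g` with `∑ g²` maximal. Forgetting the last
coordinate maps the subspace of `Y` into that of `X`. Maximality of `g` makes this map injective;
maximality of `v` keeps `v` out of the image. Hence the dimension drops strictly
(`finrank_dilationSubspace_bordered_lt`), and induction exhibits every `X` as the compression of one
Arveson extreme point by an isometry. -/

section PosSemidef

/-! ### Positive semidefinite block matrices and their ranges. -/

variable {σ τ : Type*} [Fintype σ] [Fintype τ]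

open scoped MatrixOrder in
theorem Matrix.PosSemidef.exists_eq_conjTranspose_mul_self {M : Matrix σ σ ℂ}
    (h : M.PosSemidef) : ∃ N : Matrix σ σ ℂ, M = Nᴴ * N := by
  classical
  exact CStarAlgebra.nonneg_iff_eq_star_mul_self.mp (Matrix.nonneg_iff_posSemidef.mpr h)

theorem Matrix.range_mulVecLin_conjTranspose_mul_self (N : Matrix σ τ ℂ) :
    LinearMap.range (Nᴴ * N).mulVecLin = LinearMap.range Nᴴ.mulVecLin := by
  refine Submodule.eq_of_le_of_finrank_eq ?_ ?_
  · rw [Matrix.mulVecLin_mul]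
    exact LinearMap.range_comp_le_range _ _
  · change (Nᴴ * N).rank = Nᴴ.rank
    rw [Matrix.rank_conjTranspose_mul_self, Matrix.rank_conjTranspose]

/-- Factor the block matrix as `Nᴴ * N` with `N = [N₁ N₂]`. Then `P = N₁ᴴ N₁` and `B = N₁ᴴ N₂`,
while `N₁ᴴ N₁` and `N₁ᴴ` have the same range. -/
theorem Matrix.PosSemidef.col_mem_range {P : Matrix σ σ ℂ} {B : Matrix σ τ ℂ}
    {C : Matrix τ σ ℂ} {G : Matrix τ τ ℂ} (h : (Matrix.fromBlocks P B C G).PosSemidef) (q : τ) :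
    (fun i => B i q) ∈ LinearMap.range P.mulVecLin := by
  obtain ⟨N, hN⟩ := h.exists_eq_conjTranspose_mul_self
  have hP : P = (N.submatrix id Sum.inl)ᴴ * N.submatrix id Sum.inl := by
    ext i j
    exact congrFun (congrFun hN (Sum.inl i)) (Sum.inl j)
  rw [hP, Matrix.range_mulVecLin_conjTranspose_mul_self]
  refine ⟨fun k => N k (Sum.inr q), ?_⟩
  ext i
  exact (congrFun (congrFun hN (Sum.inl i)) (Sum.inr q)).symm

theorem Matrix.PosSemidef.norm_sq_apply_le {σ : Type*} {M : Matrix σ σ ℂ} (h : M.PosSemidef) (i j : σ) :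
    ‖M i j‖ ^ 2 ≤ (M i i).re * (M j j).re := by
  have hd := (h.submatrix ![i, j]).det_nonneg
  have hij : M j i = star (M i j) := (h.isHermitian.apply j i).symm
  have hi : ((M i i).re : ℂ) = M i i := h.isHermitian.coe_re_apply_self i
  have hj : ((M j j).re : ℂ) = M j j := h.isHermitian.coe_re_apply_self j
  rw [Matrix.det_fin_two] at hd
  simp only [Matrix.submatrix_apply, Matrix.cons_val_zero, Matrix.cons_val_one] at hd
  rw [hij, ← hi, ← hj, Complex.star_def, Complex.mul_conj, Complex.normSq_eq_norm_sq] at hd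
  norm_cast at hd
  linarith

theorem Matrix.isClosed_posSemidef : IsClosed {M : Matrix σ σ ℂ | M.PosSemidef} := by
  simp only [Matrix.posSemidef_iff_dotProduct_mulVec, Set.ofPred_and, Set.ofPred_forall]
  refine (isClosed_eq (by fun_prop) (by fun_prop)).inter (isClosed_iInter fun x => ?_)
  refine isClosed_le (by fun_prop) ?_
  exact Continuous.dotProduct (by fun_prop) (Continuous.matrix_mulVec (by fun_prop) (by fun_prop))

/-- The Hermitian matrix `[P, b; b^*, g]` obtained by adding one row and one column. -/
def Matrix.bordered {σ : Type*} (P : Matrix σ σ ℂ) (b : σ → ℂ) (g : ℝ) : Matrix (σ ⊕ Unit) (σ ⊕ Unit) ℂ :=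
  Matrix.fromBlocks P (Matrix.replicateCol Unit b) (Matrix.replicateCol Unit b)ᴴ
    (Matrix.of fun _ _ => (g : ℂ))

theorem Matrix.bordered_add_diagonal {σ : Type*} [DecidableEq σ] (P : Matrix σ σ ℂ) (b : σ → ℂ)
    (g t : ℝ) : P.bordered b g + Matrix.diagonal (Sum.elim 0 fun _ => (t : ℂ)) =
      P.bordered b (g + t) := by
  ext (i | i) (j | j) <;> simp [Matrix.bordered, Matrix.diagonal_apply]

theorem Matrix.PosSemidef.bordered_mono {σ : Type*} {P : Matrix σ σ ℂ} {b : σ → ℂ} {g g' : ℝ}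
    (h : (P.bordered b g).PosSemidef) (hg : g ≤ g') : (P.bordered b g').PosSemidef := by
  classical
  rw [← add_sub_cancel g g', ← Matrix.bordered_add_diagonal]
  refine h.add (Matrix.PosSemidef.diagonal ?_)
  rintro (i | i)
  · exact le_rfl
  · simpa using hg

theorem Matrix.PosSemidef.bordered_mulVec {P : Matrix σ σ ℂ} (hP : P.PosSemidef) (w : σ → ℂ)
    {g : ℝ} (hg : (star w ⬝ᵥ P *ᵥ w).re ≤ g) : (P.bordered (P *ᵥ w) g).PosSemidef := by
  classical
  refine Matrix.PosSemidef.bordered_mono ?_ hg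
  have hq : ((star w ⬝ᵥ P *ᵥ w).re : ℂ) = star w ⬝ᵥ P *ᵥ w := by
    have := hP.dotProduct_mulVec_nonneg w
    exact (Complex.eq_re_of_ofReal_le (r := 0) (by simpa using this)).symm
  -- With the smallest allowed corner, the bordered matrix is `[1 w]ᴴ P [1 w]`.
  convert hP.conjTranspose_mul_mul_same
    (Matrix.fromCols (1 : Matrix σ σ ℂ) (Matrix.replicateCol Unit w)) using 1
  rw [Matrix.conjTranspose_fromCols_eq_fromRows_conjTranspose, Matrix.fromRows_mul,
    Matrix.fromRows_mul_fromCols]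
  simp only [Matrix.bordered, hq, Matrix.conjTranspose_one, Matrix.one_mul, Matrix.mul_one]
  congr 1
  · rw [Matrix.replicateCol_mulVec, Matrix.conjTranspose_mul, hP.isHermitian.eq]
  · rw [Matrix.mul_assoc]
    ext i j
    simp [Matrix.mul_apply, dotProduct, Matrix.mulVec]

theorem Matrix.PosSemidef.exists_sub_vecMulVec {P : Matrix σ σ ℂ} (hP : P.PosSemidef)
    {u : σ → ℂ} (hu : u ∈ LinearMap.range P.mulVecLin) :
    ∃ ε : ℝ, 0 < ε ∧ (P - (ε : ℂ) • Matrix.vecMulVec u (star u)).PosSemidef := by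
  classical
  obtain ⟨w, rfl⟩ := hu
  set u := P.mulVecLin w with hu
  have hu' : P *ᵥ w = u := rfl
  set q := (star w ⬝ᵥ u).re with hq_def
  have h0 : 0 ≤ star w ⬝ᵥ u := hP.dotProduct_mulVec_nonneg w
  have hq : star w ⬝ᵥ u = (q : ℂ) := Complex.eq_re_of_ofReal_le (r := 0) (by simpa using h0)
  have hq0 : 0 ≤ q := by rw [hq] at h0; exact_mod_cast h0
  have hstar : star w ᵥ* P = star u := by
    rw [← hu', Matrix.star_mulVec, hP.isHermitian.eq]
  set c : ℝ := 1 / (q + 1)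
  have hc : 0 < c := by positivity
  have hcq : c * q < 1 := by
    rw [one_div_mul_eq_div, div_lt_one (by positivity)]; linarith
  -- This constant comes from expanding `(1 - c w u*)ᴴ P (1 - c w u*) = P - (2c - c²q) u u*`, where
  -- `u = P w` and `q = w* P w`; it is positive because `c q < 1`.
  refine ⟨2 * c - c ^ 2 * q, by nlinarith, ?_⟩
  convert hP.conjTranspose_mul_mul_same (1 - (c : ℂ) • Matrix.vecMulVec w (star u)) using 1
  have e1 : P * Matrix.vecMulVec w (star u) = Matrix.vecMulVec u (star u) := by
    rw [Matrix.mul_vecMulVec, hu']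
  have e2 : Matrix.vecMulVec u (star w) * P = Matrix.vecMulVec u (star u) := by
    rw [Matrix.vecMulVec_mul, hstar]
  have e3 : Matrix.vecMulVec u (star u) * Matrix.vecMulVec w (star u) =
      (q : ℂ) • Matrix.vecMulVec u (star u) := by
    have : star u ⬝ᵥ w = (q : ℂ) := by rw [← hstar, ← Matrix.dotProduct_mulVec, hu', hq]
    rw [Matrix.vecMulVec_mul_vecMulVec, this]
    simp [Matrix.vecMulVec_smul]
  simp only [Matrix.conjTranspose_sub, Matrix.conjTranspose_one, Matrix.conjTranspose_smul,
    Matrix.conjTranspose_vecMulVec, star_star, Matrix.sub_mul, Matrix.mul_sub, Matrix.one_mul,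
    Matrix.mul_one, Matrix.smul_mul, Matrix.mul_smul, e1, e2, e3,
    Complex.star_def, Complex.conj_ofReal, smul_smul]
  push_cast
  module

/-- A vector supported on the last coordinate and lying in the range leaves room to lower the
corner, so the corner can move a little in both directions. -/
theorem Matrix.PosSemidef.exists_bordered_perturb {P : Matrix σ σ ℂ} {b : σ → ℂ} {g δ : ℝ} {z : ℂ}
    (h : (P.bordered b g).PosSemidef)
    (hz : (Sum.elim 0 fun _ => z : σ ⊕ Unit → ℂ) ∈ LinearMap.range (P.bordered b g).mulVecLin) (hδ : |δ| ≤ ‖z‖) :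
    ∃ ε : ℝ, 0 < ε ∧ ∀ t : ℝ, |t| ≤ ε → (P.bordered b (g + t * δ)).PosSemidef := by
  classical
  obtain ⟨ε, hε, h'⟩ := h.exists_sub_vecMulVec hz
  rcases eq_or_ne z 0 with rfl | hz0
  · have : δ = 0 := by simpa using hδ
    exact ⟨1, one_pos, fun t _ => by simpa [this] using h⟩
  have hsub : (P.bordered b (g - ε * ‖z‖ ^ 2)).PosSemidef := by
    convert h' using 1
    rw [sub_eq_add_neg g, ← Matrix.bordered_add_diagonal, sub_eq_add_neg]
    congr 1
    ext (i | i) (j | j) <;>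
      simp [Matrix.diagonal_apply, Matrix.vecMulVec_apply, Complex.mul_conj,
        Complex.normSq_eq_norm_sq]
  refine ⟨ε * ‖z‖, by positivity, fun t ht => hsub.bordered_mono ?_⟩
  have : |t * δ| ≤ ε * ‖z‖ ^ 2 := by
    rw [abs_mul, pow_two, ← mul_assoc]
    gcongr
  linarith [neg_abs_le (t * δ)]

end PosSemidef

/-! ### Diagonal spectrahedra and their one-dimensional dilations. -/

section DiagonalSpectrahedron

variable {E C : Type*} [Fintype E]

/-- Tuples `(X e)` of positive semidefinite `σ × σ` matrices satisfying the affine constraints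
`∑ e, a c e • X e = b c • 1` with real coefficients. -/
def diagonalSpectrahedron (a : C → E → ℝ) (b : C → ℝ) (σ : Type*) [DecidableEq σ] :
    Set (E → Matrix σ σ ℂ) :=
  {X | (∀ e, (X e).PosSemidef) ∧ ∀ c, ∑ e, a c e • X e = b c • (1 : Matrix σ σ ℂ)}

/-- The directions in which a tuple `X` can be bordered by one row and one column inside the
diagonal spectrahedron with coefficients `a`. -/
def dilationSubspace {σ : Type*} [Fintype σ] (a : C → E → ℝ) (X : E → Matrix σ σ ℂ) :
    Submodule ℂ (E → σ → ℂ) where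
  carrier := {v | (∀ e, v e ∈ LinearMap.range (X e).mulVecLin) ∧ ∀ c, ∑ e, a c e • v e = 0}
  zero_mem' := ⟨fun _ => Submodule.zero_mem _, fun _ => by simp⟩
  add_mem' h h' := ⟨fun e => Submodule.add_mem _ (h.1 e) (h'.1 e), fun c => by
    simp [smul_add, Finset.sum_add_distrib, h.2 c, h'.2 c]⟩
  smul_mem' z v h := ⟨fun e => Submodule.smul_mem _ z (h.1 e), fun c => by
    simp only [Pi.smul_apply, smul_comm _ z, ← Finset.smul_sum, h.2 c, smul_zero]⟩

theorem conjTranspose_mul_mul_mem_diagonalSpectrahedron {σ τ : Type*} [Fintype σ] [DecidableEq σ]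
    [Finite τ] [DecidableEq τ] {a : C → E → ℝ} {b : C → ℝ} {X : E → Matrix σ σ ℂ}
    (hX : X ∈ diagonalSpectrahedron a b σ) {V : Matrix σ τ ℂ} (hV : Vᴴ * V = 1) :
    (fun e => Vᴴ * X e * V) ∈ diagonalSpectrahedron a b τ := by
  refine ⟨fun e => (hX.1 e).conjTranspose_mul_mul_same V, fun c => ?_⟩
  have := congrArg (fun M => Vᴴ * M * V) (hX.2 c)
  simpa [Matrix.mul_sum, Matrix.sum_mul, hV] using this

theorem submatrix_equiv_mem_diagonalSpectrahedron {σ τ : Type*} [DecidableEq σ]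
    [DecidableEq τ] {a : C → E → ℝ} {b : C → ℝ} {X : E → Matrix σ σ ℂ}
    (hX : X ∈ diagonalSpectrahedron a b σ) (f : τ ≃ σ) :
    (fun e => (X e).submatrix f f) ∈ diagonalSpectrahedron a b τ := by
  refine ⟨fun e => (hX.1 e).submatrix f, fun c => ?_⟩
  have := congrArg (fun M => M.submatrix f f) (hX.2 c)
  ext i j
  have := congrFun (congrFun this i) j
  simpa [Matrix.sum_apply, Matrix.one_apply] using this

theorem bordered_mem_diagonalSpectrahedron_iff {σ : Type*} [DecidableEq σ]
    {a : C → E → ℝ} {b : C → ℝ} {X : E → Matrix σ σ ℂ} {v : E → σ → ℂ} {g : E → ℝ} :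
    (fun e => (X e).bordered (v e) (g e)) ∈ diagonalSpectrahedron a b (σ ⊕ Unit) ↔
      (∀ e, ((X e).bordered (v e) (g e)).PosSemidef) ∧
        (∀ c, ∑ e, a c e • X e = b c • (1 : Matrix σ σ ℂ)) ∧
        (∀ c, ∑ e, a c e • v e = 0) ∧ ∀ c, ∑ e, a c e * g e = b c := by
  refine and_congr_right fun _ => ⟨fun h => ⟨fun c => ?_, fun c => ?_, fun c => ?_⟩, ?_⟩
  · ext i j
    simpa [Matrix.sum_apply, Matrix.bordered, Matrix.one_apply] using
      congrFun (congrFun (h c) (Sum.inl i)) (Sum.inl j)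
  · ext i
    simpa [Matrix.sum_apply, Matrix.bordered, Matrix.one_apply] using
      congrFun (congrFun (h c) (Sum.inl i)) (Sum.inr ())
  · have := congrFun (congrFun (h c) (Sum.inr ())) (Sum.inr ())
    simp only [Matrix.sum_apply, Matrix.smul_apply, Matrix.bordered, Matrix.fromBlocks_apply₂₂,
      Matrix.of_apply, Matrix.one_apply_eq, Complex.real_smul, mul_one] at this
    exact_mod_cast this
  · rintro ⟨hX, hv, hg⟩ c
    ext (i | i) (j | j)
    · simpa [Matrix.sum_apply, Matrix.bordered, Matrix.one_apply] using
        congrFun (congrFun (hX c) i) j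
    · simpa [Matrix.sum_apply, Matrix.bordered, Matrix.one_apply] using congrFun (hv c) i
    · have := congrArg star (congrFun (hv c) j)
      simpa [Matrix.sum_apply, Matrix.bordered, Matrix.one_apply] using this
    · simp only [Matrix.sum_apply, Matrix.smul_apply, Matrix.bordered, Matrix.fromBlocks_apply₂₂,
        Matrix.of_apply, Matrix.one_apply_eq, Complex.real_smul, mul_one]
      exact_mod_cast hg c

theorem mem_dilationSubspace_of_fromBlocks {σ τ : Type*} [Fintype σ] [DecidableEq σ]
    [Finite τ] [DecidableEq τ] {a : C → E → ℝ} {b : C → ℝ} {X : E → Matrix σ σ ℂ}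
    {B : E → Matrix σ τ ℂ} {B' : E → Matrix τ σ ℂ} {G : E → Matrix τ τ ℂ}
    (h : (fun e => Matrix.fromBlocks (X e) (B e) (B' e) (G e)) ∈
      diagonalSpectrahedron a b (σ ⊕ τ)) (q : τ) :
    (fun e i => B e i q) ∈ dilationSubspace a X := by
  cases nonempty_fintype τ
  refine ⟨fun e => (h.1 e).col_mem_range q, fun c => ?_⟩
  ext i
  simpa [Matrix.sum_apply, Matrix.one_apply] using
    congrFun (congrFun (h.2 c) (Sum.inl i)) (Sum.inr q)

/-- The positive scalar solution `p` serves as the corner: it satisfies the inhomogeneous equations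
and dominates `ε² w* X w`, the least corner compatible with the border `ε X w`, once `ε` is small.
-/
theorem exists_bordered_mem_diagonalSpectrahedron {σ : Type*} [Fintype σ] [DecidableEq σ]
    {a : C → E → ℝ} {b : C → ℝ} {p : E → ℝ} (hp : ∀ e, 0 < p e)
    (hpb : ∀ c, ∑ e, a c e * p e = b c) {X : E → Matrix σ σ ℂ}
    (hX : X ∈ diagonalSpectrahedron a b σ) {v : E → σ → ℂ} (hv : v ∈ dilationSubspace a X) :
    ∃ ε : ℝ, 0 < ε ∧ (fun e => (X e).bordered (ε • v e) (p e)) ∈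
      diagonalSpectrahedron a b (σ ⊕ Unit) := by
  choose w hw using hv.1
  have hsmall : ∀ᶠ ε in nhdsWithin (0 : ℝ) (Set.Ioi 0),
      ∀ e, ε ^ 2 * (star (w e) ⬝ᵥ X e *ᵥ w e).re < p e := by
    refine Filter.eventually_all.mpr fun e => ?_
    have : Continuous fun ε : ℝ => ε ^ 2 * (star (w e) ⬝ᵥ X e *ᵥ w e).re := by fun_prop
    refine nhdsWithin_le_nhds ((this.tendsto 0).eventually_lt_const ?_)
    simpa using hp e
  obtain ⟨ε, hε, hε0⟩ := (hsmall.and self_mem_nhdsWithin).exists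
  refine ⟨ε, hε0, bordered_mem_diagonalSpectrahedron_iff.mpr ⟨fun e => ?_, hX.2, fun c => ?_, hpb⟩⟩
  · have : ε • v e = X e *ᵥ (ε • w e) := by rw [Matrix.mulVec_smul, ← hw e]; rfl
    rw [this]
    refine (hX.1 e).bordered_mulVec _ ?_
    have : star (ε • w e) ⬝ᵥ X e *ᵥ (ε • w e) = ε • ε • (star (w e) ⬝ᵥ X e *ᵥ w e) := by
      simp [Matrix.mulVec_smul, star_smul]
    rw [this, Complex.smul_re, Complex.smul_re, smul_eq_mul, smul_eq_mul, ← mul_assoc, ← pow_two]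
    exact (hε e).le
  · simp only [smul_comm _ ε, ← Finset.smul_sum, hv.2 c, smul_zero]

theorem isClosed_diagonalSpectrahedron {σ : Type*} [Finite σ] [DecidableEq σ]
    (a : C → E → ℝ) (b : C → ℝ) : IsClosed (diagonalSpectrahedron a b σ) := by
  cases nonempty_fintype σ
  have hset : diagonalSpectrahedron a b σ =
      (⋂ e, (fun X : E → Matrix σ σ ℂ => X e) ⁻¹' {M | M.PosSemidef}) ∩
        ⋂ c, {X | ∑ e, a c e • X e = b c • 1} := by
    ext X
    simp [diagonalSpectrahedron]
  have hcont : ∀ c, Continuous fun X : E → Matrix σ σ ℂ => ∑ e, a c e • X e := fun c =>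
    by fun_prop
  rw [hset]
  exact (isClosed_iInter fun e => Matrix.isClosed_posSemidef.preimage (continuous_apply e)).inter
    (isClosed_iInter fun c => isClosed_eq (hcont c) continuous_const)

/-- An equation with nonnegative coefficients bounds the diagonal entries, and the 2 × 2 minors then
bound all the others. -/
theorem isCompact_bordered_mem_diagonalSpectrahedron {σ : Type*} [Finite σ] [DecidableEq σ]
    {a : C → E → ℝ} {b : C → ℝ} (ha : ∀ e, ∃ c, (∀ e', 0 ≤ a c e') ∧ 0 < a c e)
    (X : E → Matrix σ σ ℂ) :
    IsCompact {p : (E → σ → ℂ) × (E → ℝ) |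
      (fun e => (X e).bordered (p.1 e) (p.2 e)) ∈ diagonalSpectrahedron a b (σ ⊕ Unit)} := by
  cases nonempty_fintype σ
  refine Metric.isCompact_of_isClosed_isBounded ?_ ?_
  · have hb : ∀ e, Continuous fun p : (E → σ → ℂ) × (E → ℝ) => (X e).bordered (p.1 e) (p.2 e) := by
      intro e
      unfold Matrix.bordered
      refine Continuous.matrix_fromBlocks continuous_const ?_ ?_ ?_
      · exact Continuous.matrix_replicateCol (by fun_prop)
      · exact (Continuous.matrix_replicateCol (by fun_prop)).matrix_conjTranspose
      · exact continuous_matrix fun _ _ => by simpa using by fun_prop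
    exact (isClosed_diagonalSpectrahedron a b).preimage (continuous_pi hb)
  · choose c hc0 hc using ha
    have hbound : ∀ Y ∈ diagonalSpectrahedron a b (σ ⊕ Unit), ∀ e i,
        (Y e i i).re ≤ |b (c e)| / a (c e) e := by
      intro Y hY e i
      rw [le_div_iff₀ (hc e), mul_comm]
      have h1 := congrArg Complex.re (congrFun (congrFun (hY.2 (c e)) i) i)
      simp only [Matrix.sum_apply, Matrix.smul_apply, Complex.re_sum, Complex.smul_re,
        Matrix.one_apply_eq, smul_eq_mul, Complex.one_re, mul_one] at h1
      refine le_trans ?_ (h1.le.trans (le_abs_self _))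
      refine Finset.single_le_sum (f := fun e' => a (c e) e' * (Y e' i i).re)
        (fun e' _ => mul_nonneg (hc0 e e') ?_) (Finset.mem_univ e)
      exact (Complex.nonneg_iff.mp (hY.1 e').diag_nonneg).1
    set K := ∑ e, |b (c e)| / a (c e) e
    have hK : ∀ e, |b (c e)| / a (c e) e ≤ K := fun e =>
      Finset.single_le_sum (f := fun e => |b (c e)| / a (c e) e)
        (fun e _ => div_nonneg (abs_nonneg _) (hc e).le) (Finset.mem_univ e)
    have hK0 : 0 ≤ K := Finset.sum_nonneg fun e _ => div_nonneg (abs_nonneg _) (hc e).le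
    have hentry : ∀ Y ∈ diagonalSpectrahedron a b (σ ⊕ Unit), ∀ e i j, ‖Y e i j‖ ≤ K := by
      intro Y hY e i j
      refine le_of_sq_le_sq ?_ hK0
      refine ((hY.1 e).norm_sq_apply_le i j).trans ?_
      rw [pow_two]
      exact mul_le_mul ((hbound Y hY e i).trans (hK e)) ((hbound Y hY e j).trans (hK e))
        (Complex.nonneg_iff.mp (hY.1 e).diag_nonneg).1 hK0
    refine isBounded_iff_forall_norm_le.mpr ⟨K, fun p hp => ?_⟩
    refine norm_prod_le_iff.mpr ⟨?_, ?_⟩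
    · refine (pi_norm_le_iff_of_nonneg hK0).mpr fun e => (pi_norm_le_iff_of_nonneg hK0).mpr fun i => ?_
      exact hentry _ hp e (Sum.inl i) (Sum.inr ())
    · refine (pi_norm_le_iff_of_nonneg hK0).mpr fun e => ?_
      simpa [Matrix.bordered] using hentry _ hp e (Sum.inr ()) (Sum.inr ())

end DiagonalSpectrahedron

/-! ### Maximal one-dimensional dilations and the dimension drop. -/

section MaximalDilation

/-- The map `(x, y) ↦ (x, s y, t y)` as a matrix. -/
def splitLastCoordinate (σ : Type*) [DecidableEq σ] (s t : ℝ) :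
    Matrix ((σ ⊕ Unit) ⊕ Unit) (σ ⊕ Unit) ℂ :=
  Matrix.fromRows (Matrix.fromBlocks 1 0 0 (Matrix.of fun _ _ => (s : ℂ)))
    (Matrix.fromCols 0 (Matrix.of fun _ _ => (t : ℂ)))

theorem conjTranspose_mul_splitLastCoordinate {σ : Type*} [Fintype σ] [DecidableEq σ] {s t : ℝ}
    (h : s ^ 2 + t ^ 2 = 1) :
    (splitLastCoordinate σ s t)ᴴ * splitLastCoordinate σ s t = 1 := by
  have h' : (s : ℂ) * s + t * t = 1 := by rw [← pow_two, ← pow_two]; exact_mod_cast h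
  ext (i | i) (j | j) <;>
    simp [splitLastCoordinate, Matrix.mul_apply, Fintype.sum_sum_type, Matrix.one_apply, h', eq_comm]

theorem splitLastCoordinate_compress_bordered {σ : Type*} [Fintype σ] [DecidableEq σ] (s t : ℝ)
    (P : Matrix σ σ ℂ) (v v' : σ → ℂ) (z : ℂ) (g p : ℝ) :
    (splitLastCoordinate σ s t)ᴴ * (P.bordered v g).bordered (Sum.elim v' fun _ => z) p *
        splitLastCoordinate σ s t =
      P.bordered (s • v + t • v') (s ^ 2 * g + 2 * s * t * z.re + t ^ 2 * p) := by
  ext (i | i) (j | j)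
  · simp [splitLastCoordinate, Matrix.bordered, Matrix.mul_apply, Fintype.sum_sum_type,
      Matrix.one_apply]
  · simp [splitLastCoordinate, Matrix.bordered, Matrix.mul_apply, Fintype.sum_sum_type,
      Matrix.one_apply]
    ring
  · simp [splitLastCoordinate, Matrix.bordered, Matrix.mul_apply, Fintype.sum_sum_type,
      Matrix.one_apply]
  · have hz : z + (starRingEnd ℂ) z = 2 * (z.re : ℂ) := by
      rw [Complex.add_conj]; push_cast; ring
    simp [splitLastCoordinate, Matrix.bordered, Matrix.mul_apply, Fintype.sum_sum_type]
    linear_combination (s * t : ℂ) * hz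

variable {E C : Type*} [Fintype E] {a : C → E → ℝ} {b : C → ℝ}
  {σ : Type*} [Fintype σ] [DecidableEq σ]

theorem exists_maximal_bordered (ha : ∀ e, ∃ c, (∀ e', 0 ≤ a c e') ∧ 0 < a c e) {p : E → ℝ}
    (hp : ∀ e, 0 < p e) (hpb : ∀ c, ∑ e, a c e * p e = b c) {X : E → Matrix σ σ ℂ}
    (hX : X ∈ diagonalSpectrahedron a b σ) (h : dilationSubspace a X ≠ ⊥) :
    ∃ (v : E → σ → ℂ) (g : E → ℝ), v ≠ 0 ∧
      (fun e => (X e).bordered (v e) (g e)) ∈ diagonalSpectrahedron a b (σ ⊕ Unit) ∧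
      (∀ (v' : E → σ → ℂ) (g' : E → ℝ), (fun e => (X e).bordered (v' e) (g' e)) ∈
        diagonalSpectrahedron a b (σ ⊕ Unit) → ‖v'‖ ≤ ‖v‖) ∧
      ∀ g' : E → ℝ, (fun e => (X e).bordered (v e) (g' e)) ∈
        diagonalSpectrahedron a b (σ ⊕ Unit) → ∑ e, g' e ^ 2 ≤ ∑ e, g e ^ 2 := by
  obtain ⟨u, hu, hu0⟩ := (Submodule.ne_bot_iff _).mp h
  obtain ⟨ε, hε, hmem⟩ := exists_bordered_mem_diagonalSpectrahedron hp hpb hX hu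
  obtain ⟨K, hKdef⟩ : ∃ K : Set ((E → σ → ℂ) × (E → ℝ)), K = {q |
    (fun e => (X e).bordered (q.1 e) (q.2 e)) ∈ diagonalSpectrahedron a b (σ ⊕ Unit)} := ⟨_, rfl⟩
  have hK : IsCompact K := hKdef ▸ isCompact_bordered_mem_diagonalSpectrahedron ha X
  have hKmem : ∀ v g, (v, g) ∈ K ↔ (fun e => (X e).bordered (v e) (g e)) ∈
      diagonalSpectrahedron a b (σ ⊕ Unit) := fun v g => by rw [hKdef]; rfl
  have hnorm : Continuous fun q : (E → σ → ℂ) × (E → ℝ) => ‖q.1‖ := by fun_prop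
  have hsq : Continuous fun q : (E → σ → ℂ) × (E → ℝ) => ∑ e, q.2 e ^ 2 := by fun_prop
  obtain ⟨⟨v, g₀⟩, hv, hvmax⟩ :=
    hK.exists_isMaxOn ⟨(ε • u, p), (hKmem _ _).mpr hmem⟩ hnorm.continuousOn
  rw [isMaxOn_iff] at hvmax
  have hv0 : v ≠ 0 := by
    refine norm_pos_iff.mp (lt_of_lt_of_le (norm_pos_iff.mpr (smul_ne_zero hε.ne' hu0))
      (hvmax (ε • u, p) ((hKmem _ _).mpr hmem)))
  obtain ⟨⟨v₁, g⟩, ⟨hg, hg₁⟩, hgmax⟩ := (hK.inter_right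
    ((isClosed_singleton (x := v)).preimage continuous_fst)).exists_isMaxOn ⟨(v, g₀), hv, rfl⟩
    hsq.continuousOn
  rw [isMaxOn_iff] at hgmax
  -- The second maximum is taken over the compact fibre above the `v` already chosen.
  obtain rfl : v₁ = v := hg₁
  exact ⟨v₁, g, hv0, (hKmem _ _).mp hg, fun v' g' h' => hvmax (v', g') ((hKmem _ _).mpr h'),
    fun g' h' => hgmax (v₁, g') ⟨(hKmem _ _).mpr h', rfl⟩⟩

/-- Both `g + tδ` and `g - tδ` are feasible for small `t`. Since `∑ g²` is strictly convex, a
maximiser cannot be the midpoint of a nontrivial segment. -/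
theorem eq_zero_of_sum_sq_maximal {X : E → Matrix σ σ ℂ} {v : E → σ → ℂ} {g : E → ℝ}
    (hY : (fun e => (X e).bordered (v e) (g e)) ∈ diagonalSpectrahedron a b (σ ⊕ Unit))
    (hg : ∀ g' : E → ℝ, (fun e => (X e).bordered (v e) (g' e)) ∈
      diagonalSpectrahedron a b (σ ⊕ Unit) → ∑ e, g' e ^ 2 ≤ ∑ e, g e ^ 2)
    {z : E → ℂ} (hz : ∀ e, (Sum.elim 0 fun _ => z e : σ ⊕ Unit → ℂ) ∈
      LinearMap.range ((X e).bordered (v e) (g e)).mulVecLin)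
    {δ : E → ℝ} (hδ : ∀ e, |δ e| ≤ ‖z e‖) (hδ' : ∀ c, ∑ e, a c e * δ e = 0) : δ = 0 := by
  choose ε hε hpert using fun e => (hY.1 e).exists_bordered_perturb (hz e) (hδ e)
  obtain ⟨t, htε, ht⟩ : ∃ t : ℝ, (∀ e, t < ε e) ∧ 0 < t := by
    have : ∀ᶠ t in nhdsWithin (0 : ℝ) (Set.Ioi 0), ∀ e, t < ε e :=
      Filter.eventually_all.mpr fun e => nhdsWithin_le_nhds (eventually_lt_nhds (hε e))
    exact (this.and self_mem_nhdsWithin).exists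
  have hY' := bordered_mem_diagonalSpectrahedron_iff.mp hY
  have key : ∀ s : ℝ, |s| = t → ∑ e, (g e + s * δ e) ^ 2 ≤ ∑ e, g e ^ 2 := by
    intro s hs
    refine hg _ (bordered_mem_diagonalSpectrahedron_iff.mpr
      ⟨fun e => hpert e s (hs.trans_lt (htε e)).le, hY'.2.1, hY'.2.2.1, fun c => ?_⟩)
    simp only [mul_add, Finset.sum_add_distrib, hY'.2.2.2 c, mul_left_comm _ s, ← Finset.mul_sum,
      hδ' c, mul_zero, add_zero]
  have h1 := key t (abs_of_pos ht)
  have h2 := key (-t) (by rw [abs_neg, abs_of_pos ht])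
  have h3 : ∑ e, (g e + t * δ e) ^ 2 + ∑ e, (g e + -t * δ e) ^ 2 =
      2 * ∑ e, g e ^ 2 + 2 * t ^ 2 * ∑ e, δ e ^ 2 := by
    rw [← Finset.sum_add_distrib, Finset.mul_sum, Finset.mul_sum, ← Finset.sum_add_distrib]
    exact Finset.sum_congr rfl fun e _ => by ring
  have h4 : 0 ≤ ∑ e, δ e ^ 2 := Finset.sum_nonneg fun e _ => sq_nonneg _
  have h5 : ∑ e, δ e ^ 2 = 0 := by
    have : 0 < 2 * t ^ 2 := by positivity
    nlinarith
  ext e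
  have := (Finset.sum_eq_zero_iff_of_nonneg fun e _ => sq_nonneg (δ e)).mp h5 e (Finset.mem_univ e)
  simpa using this

/-- Otherwise dilate once more along `ε (v, z)` and merge the two added coordinates by the unit
vector `(1, ε) / r`, `r = √(1 + ε²)`. The result is a dilation of `X` with border `r v`, longer than
`v`. -/
theorem not_mem_dilationSubspace_of_norm_maximal {p : E → ℝ}
    (hp : ∀ e, 0 < p e) (hpb : ∀ c, ∑ e, a c e * p e = b c)
    {X : E → Matrix σ σ ℂ} {v : E → σ → ℂ} (hv : v ≠ 0) {g : E → ℝ}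
    (hY : (fun e => (X e).bordered (v e) (g e)) ∈ diagonalSpectrahedron a b (σ ⊕ Unit))
    (hmax : ∀ (v' : E → σ → ℂ) (g' : E → ℝ), (fun e => (X e).bordered (v' e) (g' e)) ∈
      diagonalSpectrahedron a b (σ ⊕ Unit) → ‖v'‖ ≤ ‖v‖) (z : E → ℂ) :
    (fun e => Sum.elim (v e) fun _ => z e) ∉
      dilationSubspace a fun e => (X e).bordered (v e) (g e) := by
  intro hmem
  obtain ⟨ε, hε, h⟩ := exists_bordered_mem_diagonalSpectrahedron hp hpb hY hmem
  set r := √(1 + ε ^ 2) with hr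
  have hr2 : r ^ 2 = 1 + ε ^ 2 := Real.sq_sqrt (by positivity)
  have hr0 : 0 < r := by positivity
  have hst : (1 / r) ^ 2 + (ε / r) ^ 2 = 1 := by
    field_simp
    exact hr2.symm
  have h' := conjTranspose_mul_mul_mem_diagonalSpectrahedron h
    (conjTranspose_mul_splitLastCoordinate (σ := σ) hst)
  have he : ∀ e, (ε • Sum.elim (v e) fun _ => z e : σ ⊕ Unit → ℂ) =
      Sum.elim (ε • v e) fun _ => ε • z e := by
    intro e
    ext (i | i) <;> rfl
  simp only [he, splitLastCoordinate_compress_bordered] at h'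
  have hle := hmax _ _ h'
  have hs : (fun e => (1 / r) • v e + (ε / r) • ε • v e) = r • v := by
    ext e i
    have : 1 / r + ε / r * ε = r := by
      field_simp
      linarith
    simp only [smul_smul, ← add_smul, this, Pi.smul_apply]
  rw [hs, norm_smul, Real.norm_of_nonneg hr0.le] at hle
  have hv0 := norm_pos_iff.mpr hv
  have hr1 : 1 < r := by
    by_contra hcon
    nlinarith [sq_nonneg (1 - r), pow_pos hε 2]
  nlinarith

theorem finrank_dilationSubspace_bordered_lt {p : E → ℝ}
    (hp : ∀ e, 0 < p e) (hpb : ∀ c, ∑ e, a c e * p e = b c)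
    {X : E → Matrix σ σ ℂ} {v : E → σ → ℂ} (hv : v ≠ 0) {g : E → ℝ}
    (hY : (fun e => (X e).bordered (v e) (g e)) ∈ diagonalSpectrahedron a b (σ ⊕ Unit))
    (hmax : ∀ (v' : E → σ → ℂ) (g' : E → ℝ), (fun e => (X e).bordered (v' e) (g' e)) ∈
      diagonalSpectrahedron a b (σ ⊕ Unit) → ‖v'‖ ≤ ‖v‖)
    (hg : ∀ g' : E → ℝ, (fun e => (X e).bordered (v e) (g' e)) ∈
      diagonalSpectrahedron a b (σ ⊕ Unit) → ∑ e, g' e ^ 2 ≤ ∑ e, g e ^ 2) :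
    Module.finrank ℂ (dilationSubspace a fun e => (X e).bordered (v e) (g e)) <
      Module.finrank ℂ (dilationSubspace a X) := by
  set D := dilationSubspace a fun e => (X e).bordered (v e) (g e)
  have hvX : v ∈ dilationSubspace a X := mem_dilationSubspace_of_fromBlocks hY ()
  let φ : (E → σ ⊕ Unit → ℂ) →ₗ[ℂ] (E → σ → ℂ) :=
    { toFun := fun u e i => u e (Sum.inl i)
      map_add' := fun _ _ => rfl
      map_smul' := fun _ _ => rfl }
  have hφ : ∀ u e i, φ u e i = u e (Sum.inl i) := fun _ _ _ => rfl
  have hdecomp : ∀ u : E → σ ⊕ Unit → ℂ,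
      u = fun e => Sum.elim (φ u e) fun _ => u e (Sum.inr ()) := by
    intro u
    ext e (i | i) <;> rfl
  have hinj : LinearMap.ker (φ.domRestrict D) = ⊥ := by
    refine (LinearMap.ker_eq_bot').mpr ?_
    rintro ⟨u, hu⟩ (h0 : φ u = 0)
    have hrange : ∀ e, (Sum.elim 0 fun _ => u e (Sum.inr ()) : σ ⊕ Unit → ℂ) ∈
        LinearMap.range ((X e).bordered (v e) (g e)).mulVecLin := by
      intro e
      have := hu.1 e
      rw [hdecomp u, h0] at this
      exact this
    have hsum : ∀ c, ∑ e, a c e • u e (Sum.inr ()) = 0 := fun c => by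
      simpa using congrFun (hu.2 c) (Sum.inr ())
    -- Corners are real and the coefficients `a` are real, so real and imaginary parts are separate
    -- admissible perturbations.
    have hre := eq_zero_of_sum_sq_maximal hY hg hrange (δ := fun e => (u e (Sum.inr ())).re)
      (fun e => Complex.abs_re_le_norm _) (fun c => by simpa using congrArg Complex.re (hsum c))
    have him := eq_zero_of_sum_sq_maximal hY hg hrange (δ := fun e => (u e (Sum.inr ())).im)
      (fun e => Complex.abs_im_le_norm _) (fun c => by simpa using congrArg Complex.im (hsum c))
    have : u = 0 := by
      rw [hdecomp u, h0]
      ext e (i | i)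
      · rfl
      · exact Complex.ext (congrFun hre e) (congrFun him e)
    simpa using this
  have hle : D.map φ ≤ dilationSubspace a X := by
    rintro _ ⟨u, hu, rfl⟩
    refine ⟨fun e => ?_, fun c => ?_⟩
    · obtain ⟨w, hw⟩ := hu.1 e
      have : φ u e = X e *ᵥ (fun i => w (Sum.inl i)) + w (Sum.inr ()) • v e := by
        ext i
        have := congrFun hw (Sum.inl i)
        simp only [Matrix.mulVecLin_apply, Matrix.mulVec, dotProduct, Fintype.sum_sum_type,
          Matrix.bordered] at this
        simpa [hφ, Matrix.mulVec, dotProduct, mul_comm] using this.symm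
      rw [this]
      exact Submodule.add_mem _ ⟨_, rfl⟩ (Submodule.smul_mem _ _ (hvX.1 e))
    · ext i
      simpa [hφ] using congrFun (hu.2 c) (Sum.inl i)
  have hlt : D.map φ < dilationSubspace a X := by
    refine lt_of_le_of_ne hle fun heq => ?_
    obtain ⟨u, hu, huv⟩ := heq.ge hvX
    have hnot := not_mem_dilationSubspace_of_norm_maximal hp hpb hv hY hmax
      fun e => u e (Sum.inr ())
    have hu' := hdecomp u
    rw [huv] at hu'
    rw [← hu'] at hnot
    exact hnot hu
  calc Module.finrank ℂ D = Module.finrank ℂ (D.map φ) := by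
        rw [← LinearMap.range_domRestrict]
        exact (LinearMap.finrank_range_of_inj (LinearMap.ker_eq_bot.mp hinj)).symm
    _ < _ := Submodule.finrank_lt_finrank_of_lt hlt

/-- Every tuple in the diagonal spectrahedron is a compression of one without nontrivial
dilations. -/
theorem exists_compression_dilationSubspace_eq_bot {a : C → E → ℝ} {b : C → ℝ}
    (ha : ∀ e, ∃ c, (∀ e', 0 ≤ a c e') ∧ 0 < a c e) {p : E → ℝ}
    (hp : ∀ e, 0 < p e) (hpb : ∀ c, ∑ e, a c e * p e = b c) (d : ℕ) :
    ∀ {σ : Type} [Fintype σ] [DecidableEq σ] [Nonempty σ] (X : E → Matrix σ σ ℂ),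
      X ∈ diagonalSpectrahedron a b σ → Module.finrank ℂ (dilationSubspace a X) = d →
      ∃ (s : ℕ+) (Y : E → Matrix (Fin s) (Fin s) ℂ) (V : Matrix (Fin s) σ ℂ),
        Y ∈ diagonalSpectrahedron a b (Fin s) ∧ dilationSubspace a Y = ⊥ ∧ Vᴴ * V = 1 ∧
          ∀ e, Vᴴ * Y e * V = X e := by
  induction d using Nat.strong_induction_on with
  | _ d ih =>
    intro σ _ _ _ X hX hd
    by_cases h : dilationSubspace a X = ⊥
    · obtain ⟨s, ⟨f⟩⟩ : ∃ s : ℕ+, Nonempty (Fin s ≃ σ) :=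
        ⟨⟨Fintype.card σ, Fintype.card_pos⟩, ⟨(Fintype.equivFin σ).symm⟩⟩
      have hV : ∀ M : Matrix σ σ ℂ, ((1 : Matrix σ σ ℂ).submatrix f id)ᴴ * M.submatrix f f *
          (1 : Matrix σ σ ℂ).submatrix f id = M := by
        intro M
        rw [Matrix.conjTranspose_submatrix, Matrix.conjTranspose_one,
          Matrix.submatrix_mul_equiv, Matrix.submatrix_mul_equiv]
        simp
      refine ⟨s, fun e => (X e).submatrix f f,
        (1 : Matrix σ σ ℂ).submatrix f id, submatrix_equiv_mem_diagonalSpectrahedron hX f,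
        ?_, ?_, fun e => hV (X e)⟩
      · refine (Submodule.eq_bot_iff _).mpr fun v hv => ?_
        have : (fun e i => v e (f.symm i)) ∈ dilationSubspace a X := by
          refine ⟨fun e => ?_, fun c => ?_⟩
          · obtain ⟨w, hw⟩ := hv.1 e
            refine ⟨w ∘ f.symm, ?_⟩
            have hw' : (X e).submatrix f f *ᵥ w = v e := hw
            rw [Matrix.submatrix_mulVec_equiv] at hw'
            ext i
            simpa using congrFun hw' (f.symm i)
          · ext i
            simpa [Finset.sum_apply] using congrFun (hv.2 c) (f.symm i)
        rw [h, Submodule.mem_bot] at this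
        ext e i
        simpa using congrFun (congrFun this e) (f i)
      · rw [Matrix.conjTranspose_submatrix, Matrix.conjTranspose_one, Matrix.submatrix_mul_equiv]
        simp
    · obtain ⟨v, g, hv, hY, hmax, hg⟩ := exists_maximal_bordered ha hp hpb hX h
      have hlt := finrank_dilationSubspace_bordered_lt hp hpb hv hY hmax hg
      obtain ⟨s, Z, V, hZ, hZbot, hV, hVZ⟩ := ih _ (hd ▸ hlt) _ hY rfl
      -- The inclusion of `σ` undoes the bordering; composing it with `V` compresses `Z` to `X`.
      let W : Matrix (σ ⊕ Unit) σ ℂ := Matrix.fromRows 1 0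
      have hW : ∀ M : Matrix (σ ⊕ Unit) (σ ⊕ Unit) ℂ, Wᴴ * M * W = M.submatrix Sum.inl Sum.inl := by
        intro M
        ext i j
        simp [W, Matrix.mul_apply, Matrix.one_apply]
      have hVW : ∀ M : Matrix (Fin s) (Fin s) ℂ, (V * W)ᴴ * M * (V * W) = Wᴴ * (Vᴴ * M * V) * W := by
        intro M
        simp only [Matrix.conjTranspose_mul, Matrix.mul_assoc]
      refine ⟨s, Z, V * W, hZ, hZbot, ?_, fun e => ?_⟩
      · have := hVW 1
        rw [Matrix.mul_one, Matrix.mul_one, hV, hW] at this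
        rw [this]
        ext i j
        simp [Matrix.one_apply]
      · rw [hVW, hVZ e, hW]
        rfl

end MaximalDilation

/-! ### Graph quantum magic squares as a diagonal spectrahedron. -/

theorem isMatrixConvex_graphQuantumMagicSquares {V : Type*} [Fintype V] (Γ : SimpleGraph V)
    [DecidableRel Γ.Adj] : IsMatrixConvex (graphQuantumMagicSquares Γ) := by
  refine ⟨fun s A hA i j => (hA.1.1 i j).isHermitian, fun s t m A W hA hW => ?_⟩
  refine ⟨⟨fun i j => ?_, fun i => ?_, fun j => ?_⟩, ?_⟩
  · rw [Matrix.of_apply]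
    exact Matrix.posSemidef_sum _ fun r _ => ((hA r).1.1 i j).conjTranspose_mul_mul_same (W r)
  · simp only [Matrix.of_apply]
    rw [Finset.sum_comm, ← hW]
    refine Finset.sum_congr rfl fun r _ => ?_
    rw [← Matrix.sum_mul, ← Matrix.mul_sum, (hA r).1.2.1 i, Matrix.mul_one]
  · simp only [Matrix.of_apply]
    rw [Finset.sum_comm, ← hW]
    refine Finset.sum_congr rfl fun r _ => ?_
    rw [← Matrix.sum_mul, ← Matrix.mul_sum, (hA r).1.2.2 j, Matrix.mul_one]
  · ext1 i j
    simp only [SimpleGraph.mul_adjMatrix_apply, SimpleGraph.adjMatrix_mul_apply, Matrix.of_apply]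
    rw [Finset.sum_comm, Finset.sum_comm (s := Γ.neighborFinset i)]
    refine Finset.sum_congr rfl fun r _ => ?_
    have := congrFun (congrFun (hA r).2 i) j
    rw [SimpleGraph.mul_adjMatrix_apply, SimpleGraph.adjMatrix_mul_apply] at this
    rw [← Matrix.sum_mul, ← Matrix.mul_sum, ← Matrix.sum_mul, ← Matrix.mul_sum, this]

/-- The coefficients of the linear equations defining graph quantum magic squares: row sums,
column sums, and commutation with the adjacency matrix. -/
def magicCoeff {V : Type*} [DecidableEq V] (Γ : SimpleGraph V) [DecidableRel Γ.Adj] :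
    V ⊕ V ⊕ V × V → V × V → ℝ
  | .inl i, e => if e.1 = i then 1 else 0
  | .inr (.inl j), e => if e.2 = j then 1 else 0
  | .inr (.inr (i, j)), e =>
    (if e.1 = i ∧ Γ.Adj e.2 j then 1 else 0) - if e.2 = j ∧ Γ.Adj i e.1 then 1 else 0

/-- The right-hand sides of the linear equations defining graph quantum magic squares. -/
def magicConst (V : Type*) : V ⊕ V ⊕ V × V → ℝ
  | .inl _ => 1
  | .inr (.inl _) => 1
  | .inr (.inr _) => 0

section MagicEquations

variable {V : Type*} [Fintype V] [DecidableEq V] (Γ : SimpleGraph V) [DecidableRel Γ.Adj]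
  {M : Type*} [AddCommGroup M] [Module ℝ M] (X : V × V → M)

theorem sum_magicCoeff_row (i : V) :
    ∑ e, magicCoeff Γ (.inl i) e • X e = ∑ k, X (i, k) := by
  simp only [magicCoeff, Fintype.sum_prod_type, ite_smul, one_smul, zero_smul]
  rw [Finset.sum_comm]
  simp

theorem sum_magicCoeff_col (j : V) :
    ∑ e, magicCoeff Γ (.inr (.inl j)) e • X e = ∑ k, X (k, j) := by
  simp [magicCoeff, Fintype.sum_prod_type]

theorem sum_magicCoeff_comm (i j : V) :
    ∑ e, magicCoeff Γ (.inr (.inr (i, j))) e • X e =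
      ∑ k ∈ Γ.neighborFinset j, X (i, k) - ∑ k ∈ Γ.neighborFinset i, X (k, j) := by
  simp only [magicCoeff, sub_smul, Finset.sum_sub_distrib, ite_smul, one_smul, zero_smul,
    Fintype.sum_prod_type, ite_and]
  congr 1
  · rw [Finset.sum_comm]
    simp [← Finset.sum_filter, SimpleGraph.neighborFinset_eq_filter, SimpleGraph.adj_comm]
  · simp [← Finset.sum_filter, SimpleGraph.neighborFinset_eq_filter]

theorem mem_graphQuantumMagicSquares_iff {s : ℕ+} (A : BlockMat V s) :
    A ∈ graphQuantumMagicSquares Γ s ↔ (fun e : V × V => A e.1 e.2) ∈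
      diagonalSpectrahedron (magicCoeff Γ) (magicConst V) (Fin s) := by
  have hcomm : A * Γ.adjMatrix (Matrix (Fin s) (Fin s) ℂ) =
      Γ.adjMatrix (Matrix (Fin s) (Fin s) ℂ) * A ↔ ∀ i j, ∑ k ∈ Γ.neighborFinset j, A i k =
        ∑ k ∈ Γ.neighborFinset i, A k j := by
    rw [← Matrix.ext_iff]
    simp only [SimpleGraph.mul_adjMatrix_apply, SimpleGraph.adjMatrix_mul_apply]
  simp only [graphQuantumMagicSquares, quantumMagicSquares, diagonalSpectrahedron,
    Set.mem_ofPred_eq, hcomm, Sum.forall, Prod.forall, sum_magicCoeff_row, sum_magicCoeff_col,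
    sum_magicCoeff_comm, magicConst, one_smul, zero_smul, sub_eq_zero, and_assoc]

theorem mem_arvesonExtremePoints_graphQuantumMagicSquares {s : ℕ+} {A : BlockMat V s}
    (hA : A ∈ graphQuantumMagicSquares Γ s)
    (h : dilationSubspace (magicCoeff Γ) (fun e : V × V => A e.1 e.2) = ⊥) :
    A ∈ arvesonExtremePoints (graphQuantumMagicSquares Γ) s := by
  refine ⟨hA, fun l β γ hD i j => ?_⟩
  have h1 := submatrix_equiv_mem_diagonalSpectrahedron
    ((mem_graphQuantumMagicSquares_iff Γ _).mp hD)
    (finSumFinEquiv.trans (finCongr (PNat.add_coe s l).symm))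
  simp only [dilationMatrix, Matrix.of_apply, Matrix.reindex_apply, Matrix.submatrix_submatrix,
    Equiv.symm_comp_self, Matrix.submatrix_id_id] at h1
  ext p q
  have h2 := mem_dilationSubspace_of_fromBlocks (X := fun e : V × V => A e.1 e.2)
    (B := fun e => β e.1 e.2) h1 q
  rw [h, Submodule.mem_bot] at h2
  exact congrFun (congrFun h2 (i, j)) p

end MagicEquations

theorem graphQuantumMagicSquares_eq_matrixConvexHull {V : Type*} [Fintype V] (Γ : SimpleGraph V)
    [DecidableRel Γ.Adj] {k : ℕ} (hΓ : Γ.IsRegularOfDegree k) :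
    graphQuantumMagicSquares Γ =
      matrixConvexHull (arvesonExtremePoints (graphQuantumMagicSquares Γ)) := by
  classical
  ext s A
  refine ⟨fun hA R hR hsub => ?_, fun hA =>
    hA _ (isMatrixConvex_graphQuantumMagicSquares Γ) fun t X hX => hX.1⟩
  -- The row equation through `e` supplies the boundedness.
  have ha : ∀ e, ∃ c, (∀ e', 0 ≤ magicCoeff Γ c e') ∧ 0 < magicCoeff Γ c e := fun e =>
    ⟨.inl e.1, fun e' => by simp only [magicCoeff]; positivity, by simp [magicCoeff]⟩
  have hp : ∀ e : V × V, 0 < (Fintype.card V : ℝ)⁻¹ := fun e => by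
    have : Nonempty V := ⟨e.1⟩
    positivity
  have hpb : ∀ c, ∑ e, magicCoeff Γ c e * (Fintype.card V : ℝ)⁻¹ = magicConst V c := by
    have hcard : ∀ i : V, (Fintype.card V : ℝ) ≠ 0 := fun i => by
      have : Nonempty V := ⟨i⟩
      positivity
    rintro (i | j | ⟨i, j⟩) <;> simp only [← smul_eq_mul]
    · rw [sum_magicCoeff_row Γ fun _ => (Fintype.card V : ℝ)⁻¹]
      simp [magicConst, hcard i]
    · rw [sum_magicCoeff_col Γ fun _ => (Fintype.card V : ℝ)⁻¹]
      simp [magicConst, hcard j]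
    · rw [sum_magicCoeff_comm Γ fun _ => (Fintype.card V : ℝ)⁻¹]
      -- Regularity enters here: the commutation equation for the constant tuple compares the
      -- degrees of `i` and `j`.
      simp [magicConst, hΓ.degree_eq]
  obtain ⟨t, Y, W, hY, hbot, hW, hWY⟩ := exists_compression_dilationSubspace_eq_bot ha hp hpb _ _
    ((mem_graphQuantumMagicSquares_iff Γ A).mp hA) rfl
  let B : BlockMat V t := Matrix.of fun i j => Y (i, j)
  have hB : B ∈ arvesonExtremePoints (graphQuantumMagicSquares Γ) t :=
    mem_arvesonExtremePoints_graphQuantumMagicSquares Γ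
      ((mem_graphQuantumMagicSquares_iff Γ B).mpr hY) hbot
  have := hR.2 t s 1 (fun _ => B) (fun _ => W) (fun _ => hsub t hB) (by simpa using hW)
  convert this using 1
  ext1 i j
  simpa [B] using (hWY (i, j)).symm

theorem quantumMagicSquares_eq_graphQuantumMagicSquares_bot (V : Type*) [Fintype V] :
    quantumMagicSquares V = graphQuantumMagicSquares (⊥ : SimpleGraph V) := by
  ext s A
  refine ⟨fun h => ⟨h, ?_⟩, fun h => h.1⟩
  simp

theorem mainTheorem5 :
    (∀ n : ℕ, quantumMagicSquares (Fin n) =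
      matrixConvexHull (arvesonExtremePoints (quantumMagicSquares (Fin n)))) ∧
    (∀ (V : Type*) [Fintype V] (Γ : SimpleGraph V) [DecidableRel Γ.Adj] (k : ℕ),
      Γ.IsRegularOfDegree k →
        graphQuantumMagicSquares Γ =
          matrixConvexHull (arvesonExtremePoints (graphQuantumMagicSquares Γ))) := by
  refine ⟨fun n => ?_, fun V _ Γ _ k hΓ => graphQuantumMagicSquares_eq_matrixConvexHull Γ hΓ⟩
  -- The empty graph is 0-regular and its commutation condition is void.
  rw [quantumMagicSquares_eq_graphQuantumMagicSquares_bot]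
  exact graphQuantumMagicSquares_eq_matrixConvexHull ⊥ (k := 0) fun v => by simp
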